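/- Let $\mathbb S\subset\mathbb R$ be a finite set and let $\pmb G^Y$ be a transition rate matrix on $\mathbb S$ (nonnegative off-diagonal entries, zero row sums). Let $Y=(Y_t)_{t\ge 0}$, under a family of laws $(\mathbb P_x)_{x\in\mathbb S}$ with $\mathbb P_x[Y_0=x]=1$, be a time-homogeneous continuous-time Markov chain on $\mathbb S$ with right-continuous paths and transition rate matrix $\pmb G^Y$, that is, $\mathbb P_x[Y_{s+t}=y\mid\mathcal F_s]=e^{t\pmb G^Y}(Y_s,y)$ a.s. for all $x,y\in\mathbb S$ and $s,t\ge 0$, where $(\mathcal F_t)_{t\ge0}$ is the filtration generated by $Y$. Let $\mathcal T$ be the set of $(\mathcal F_t)$-stopping times with values in $[0,\infty]$. Let $r\ge 0$, $L\in\mathbb R$, $D\ge 0$ and $f:\mathbb R\to\mathbb R$. Put $g_{L,t}^-=\sup\{s\le t: Y_s\ge L\}$, with $\sup\emptyset=0$, and let $$\tau_{L,D}^-=\inf\{t\ge 0: t-g_{L,t}^-\ge D\}\in[0,\infty]$$ be the Parisian stopping time. Every quantity containing the factor $e^{-r\tau}$ is understood as $0$ on $\{\tau=\infty\}$. For $x,y\in\mathbb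 S$ define the price of the perpetual down-in American Parisian option, $$C_{pi}(x)=\sup_{\tau\in\mathcal T}\mathbb E_x\big[e^{-r\tau}f(Y_\tau)1_{\{\tau\ge\tau_{L,D}^-,\ \tau<\infty\}}\big],$$ the price of the perpetual vanilla American option, $$c_p(y)=\sup_{\tau\in\mathcal T}\mathbb E_y\big[e^{-r\tau}f(Y_\tau)\big],$$ and $$h_p(r,x;y)=\mathbb E_x\Big[e^{-r\tau_{L,D}^-}1_{\{Y_{\tau_{L,D}^-}=y\}}\Big].$$ Then all the expectations above exist, both suprema are finite, and for every $x\in\mathbb S$ $$C_{pi}(x)=\sum_{y\in\mathbb S}h_p(r,x;y)\,c_p(y).$$ -/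

import Mathlib

open MeasureTheory ProbabilityTheory
open scoped NNReal

namespace ParisianOption

/-- A transition rate matrix on a finite state space: nonnegative off-diagonal entries and zero
row sums. -/
structure IsRateMatrix {S : Finset ℝ} (G : Matrix S S ℝ) : Prop where
  offDiag_nonneg : ∀ x y, x ≠ y → 0 ≤ G x y
  row_sum : ∀ x, ∑ y, G x y = 0

/-- `Y`, under the family `P x` of laws (started at `x`), is a time-homogeneous continuous-time
Markov chain on the finite set `S` of reals with transition rate matrix `G`: its paths are
right-continuous, and with respect to the filtration generated by `Y` it is Markov with transition
probabilities `exp (t G)`. -/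
structure IsCTMC {Ω : Type*} [MeasurableSpace Ω] {S : Finset ℝ} (G : Matrix S S ℝ)
    (Y : ℝ≥0 → Ω → S) (P : S → Measure Ω) : Prop where
  rateMatrix : IsRateMatrix G
  isProbabilityMeasure : ∀ x, IsProbabilityMeasure (P x)
  stronglyMeasurable : ∀ t, StronglyMeasurable (Y t)
  rightContinuous : ∀ ω t, ContinuousWithinAt (fun s => Y s ω) (Set.Ici t) t
  initial : ∀ x, ∀ᵐ ω ∂(P x), Y 0 ω = x
  markov : ∀ (x y : S) (s t : ℝ≥0),
    (P x)[(Y (s + t) ⁻¹' {y}).indicator (fun _ => (1 : ℝ)) |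
        Filtration.natural Y stronglyMeasurable s]
      =ᵐ[P x] fun ω => NormedSpace.exp ((t : ℝ) • G) (Y s ω) y

section Definitions

variable {Ω : Type*} {S : Finset ℝ}

/-- The last time up to `t` at which `Y` is at or above `L`; it is `0` if there is none (the
supremum of the empty set in `ℝ≥0`), so that an excursion below `L` in progress at time `0` has
age `0` there. -/
noncomputable def lastAbove (L : ℝ) (Y : ℝ≥0 → Ω → S) (t : ℝ≥0) (ω : Ω) : ℝ≥0 :=
  sSup {s : ℝ≥0 | s ≤ t ∧ L ≤ (Y s ω : ℝ)}

/-- The Parisian time: the first time at which the current excursion of `Y` below `L` has lasted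
for `D`, and `⊤` if that never happens. Since `lastAbove L Y t ω ≤ t`, the subtraction in `ℝ≥0`
does not truncate. -/
noncomputable def parisianTime (L : ℝ) (D : ℝ≥0) (Y : ℝ≥0 → Ω → S) (ω : Ω) : WithTop ℝ≥0 :=
  sInf ((fun t : ℝ≥0 => (t : WithTop ℝ≥0)) '' {t : ℝ≥0 | D ≤ t - lastAbove L Y t ω})

/-- The discounted value `e ^ (-r τ) φ (Y_τ)`, understood as `0` on `{τ = ∞}`. -/
noncomputable def discounted (r : ℝ) (φ : S → ℝ) (Y : ℝ≥0 → Ω → S) (τ : Ω → WithTop ℝ≥0)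
    (ω : Ω) : ℝ :=
  if τ ω = ⊤ then 0
  else Real.exp (-r * ((τ ω).untopD 0 : ℝ≥0)) * φ (Y ((τ ω).untopD 0) ω)

/-- The discounted payoff of the vanilla American option with payoff `f` exercised at `τ`. -/
noncomputable def vanillaPayoff (r : ℝ) (f : ℝ → ℝ) (Y : ℝ≥0 → Ω → S) (τ : Ω → WithTop ℝ≥0)
    (ω : Ω) : ℝ :=
  discounted r (fun y => f y) Y τ ω

/-- The discounted payoff of the down-in American Parisian option exercised at `τ`:
`e ^ (-r τ) f (Y_τ) 1_{τ_{L,D}^- ≤ τ, τ < ∞}`. -/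
noncomputable def downInPayoff (r : ℝ) (f : ℝ → ℝ) (L : ℝ) (D : ℝ≥0) (Y : ℝ≥0 → Ω → S)
    (τ : Ω → WithTop ℝ≥0) (ω : Ω) : ℝ :=
  {ω' | parisianTime L D Y ω' ≤ τ ω'}.indicator (discounted r (fun y => f y) Y τ) ω

/-- The integrand `e ^ (-r τ_{L,D}^-) 1_{Y at τ_{L,D}^- equals y}` (zero if `τ_{L,D}^- = ∞`). -/
noncomputable def activation (r : ℝ) (L : ℝ) (D : ℝ≥0) (Y : ℝ≥0 → Ω → S) (y : S) (ω : Ω) : ℝ :=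
  discounted r (({y} : Set S).indicator (fun _ => 1)) Y (parisianTime L D Y) ω

variable [MeasurableSpace Ω]

/-- The expectations `E_y[e ^ (-r τ) f (Y_τ)]` over all stopping times `τ` with values in `[0, ∞]`
of the filtration generated by `Y`. -/
def vanillaRewards (r : ℝ) (f : ℝ → ℝ) (Y : ℝ≥0 → Ω → S) (hY : ∀ t, StronglyMeasurable (Y t))
    (P : S → Measure Ω) (y : S) : Set ℝ :=
  {v | ∃ τ : Ω → WithTop ℝ≥0, IsStoppingTime (Filtration.natural Y hY) τ ∧
    v = ∫ ω, vanillaPayoff r f Y τ ω ∂(P y)}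

/-- The price `c_p y` of the perpetual vanilla American option. -/
noncomputable def vanillaPrice (r : ℝ) (f : ℝ → ℝ) (Y : ℝ≥0 → Ω → S)
    (hY : ∀ t, StronglyMeasurable (Y t)) (P : S → Measure Ω) (y : S) : ℝ :=
  sSup (vanillaRewards r f Y hY P y)

/-- The expectations `E_x[e ^ (-r τ) f (Y_τ) 1_{τ_{L,D}^- ≤ τ, τ < ∞}]` over all stopping times `τ`
with values in `[0, ∞]` of the filtration generated by `Y`. -/
def downInRewards (r : ℝ) (f : ℝ → ℝ) (L : ℝ) (D : ℝ≥0) (Y : ℝ≥0 → Ω → S)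
    (hY : ∀ t, StronglyMeasurable (Y t)) (P : S → Measure Ω) (x : S) : Set ℝ :=
  {v | ∃ τ : Ω → WithTop ℝ≥0, IsStoppingTime (Filtration.natural Y hY) τ ∧
    v = ∫ ω, downInPayoff r f L D Y τ ω ∂(P x)}

/-- The price `C_pi x` of the perpetual down-in American Parisian option. -/
noncomputable def downInPrice (r : ℝ) (f : ℝ → ℝ) (L : ℝ) (D : ℝ≥0) (Y : ℝ≥0 → Ω → S)
    (hY : ∀ t, StronglyMeasurable (Y t)) (P : S → Measure Ω) (x : S) : ℝ :=
  sSup (downInRewards r f L D Y hY P x)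

/-- `h_p (r, x; y) = E_x[e ^ (-r τ_{L,D}^-) 1_{Y at τ_{L,D}^- equals y}]`. -/
noncomputable def activationTransform (r : ℝ) (L : ℝ) (D : ℝ≥0) (Y : ℝ≥0 → Ω → S)
    (P : S → Measure Ω) (x y : S) : ℝ :=
  ∫ ω, activation r L D Y y ω ∂(P x)

end Definitions

end ParisianOption

/-! Once the option is activated, at the Parisian time `σ`, the holder owns a vanilla American
option, so the price should be the expected discounted value of `c_p` at `Y_σ`; summing over the
state at `σ` gives the formula. Proving this directly would mean restarting stopping rules at `σ`,
but the sample space carries no shift. The proof avoids this by working with functions `u` on the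
state space that are attainable: from every start and every stopping time, the discounted value of
`u` there is at most the expected reward of some later stopping time.

Attainable functions include `max f 0` and are closed under pairwise maxima and, by the strong
Markov property, under the discounted semigroup. As the state space is finite, their pointwise
supremum `V` (`attainableValue`) is approximated uniformly by attainable functions. Hence `V` is
excessive and dominates `max f 0`. Optional stopping bounds every reward collected after a stopping
time by the discounted `V` at that time, and attainability gives the matching lower bound. At time
`0` this identifies `V` with `c_p` (`vanillaPrice_eq_attainableValue`), at `σ` it gives the down-in
price (`downInPrice_eq_integral`).

The filtration is neither completed nor made right-continuous, so stopping times are checked by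
hand, using that paths are constant for a while after each time. -/

namespace ParisianOption

/-! ### Optional stopping by discretization from the right -/

section StoppedExpectations

open Filter Topology

variable {Ω : Type*}

/-- The value of the process `F` at the random time `τ`, understood as `0` on `{τ = ∞}`. -/
noncomputable def atTime (F : ℝ≥0 → Ω → ℝ) (τ : Ω → WithTop ℝ≥0) (ω : Ω) : ℝ :=
  if τ ω = ⊤ then 0 else F ((τ ω).untopD 0) ω

/-- The `k`-th point of the grid of mesh `1 / (n + 1)`. -/
noncomputable def gridPoint (n k : ℕ) : ℝ≥0 := (k : ℝ≥0) / (n + 1 : ℝ≥0)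

/-- The event that `τ` falls into the `k`-th cell of the grid of mesh `1 / (n + 1)`. -/
def gridCell (τ : Ω → WithTop ℝ≥0) (n k : ℕ) : Set Ω :=
  {ω | (gridPoint n k : WithTop ℝ≥0) ≤ τ ω ∧ τ ω < (gridPoint n (k + 1) : WithTop ℝ≥0)}

/-- The process `F` sampled at the right end of the cell of the grid that contains `τ`, and `0`
from time `n + 1` on. -/
noncomputable def sampled (F : ℝ≥0 → Ω → ℝ) (τ : Ω → WithTop ℝ≥0) (n : ℕ) (ω : Ω) : ℝ :=
  ∑ k ∈ Finset.range ((n + 1) ^ 2), (gridCell τ n k).indicator (F (gridPoint n (k + 1))) ω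

theorem gridPoint_mono (n : ℕ) : Monotone (gridPoint n) := fun a b h => by
  unfold gridPoint; gcongr

theorem mem_gridCell_iff {τ : Ω → WithTop ℝ≥0} {ω : Ω} {s : ℝ≥0} (h : τ ω = s) (n k : ℕ) :
    ω ∈ gridCell τ n k ↔ k = ⌊s * (n + 1)⌋₊ := by
  have hn : (0 : ℝ≥0) < n + 1 := by positivity
  have h1 := Nat.floor_eq_iff (a := s * (n + 1)) (n := k) zero_le
  simp only [gridCell, gridPoint, Set.mem_ofPred_eq, h, WithTop.coe_le_coe, WithTop.coe_lt_coe,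
    div_le_iff₀ hn, lt_div_iff₀ hn]
  push_cast
  rw [eq_comm, h1]

theorem sampled_of_eq_coe {τ : Ω → WithTop ℝ≥0} {ω : Ω} {s : ℝ≥0} (h : τ ω = s)
    (F : ℝ≥0 → Ω → ℝ) (n : ℕ) :
    sampled F τ n ω = if ⌊s * (n + 1)⌋₊ < (n + 1) ^ 2 then
      F (gridPoint n (⌊s * (n + 1)⌋₊ + 1)) ω else 0 := by
  classical
  simp only [sampled, Set.indicator_apply, mem_gridCell_iff h, Finset.sum_ite_eq',
    Finset.mem_range]

theorem sampled_of_eq_top {τ : Ω → WithTop ℝ≥0} {ω : Ω} (h : τ ω = ⊤)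
    (F : ℝ≥0 → Ω → ℝ) (n : ℕ) : sampled F τ n ω = 0 := by
  refine Finset.sum_eq_zero fun k _ => Set.indicator_of_notMem ?_ _
  simp only [gridCell, Set.mem_ofPred_eq, h]
  exact fun h => not_top_lt h.2

theorem abs_sampled_le {F : ℝ≥0 → Ω → ℝ} {C : ℝ} (hC : ∀ t ω, |F t ω| ≤ C)
    (τ : Ω → WithTop ℝ≥0) (n : ℕ) (ω : Ω) : |sampled F τ n ω| ≤ C := by
  have hC0 : 0 ≤ C := (abs_nonneg _).trans (hC 0 ω)
  rcases eq_or_ne (τ ω) ⊤ with h | h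
  · rw [sampled_of_eq_top h]; simpa
  · obtain ⟨s, hs⟩ := WithTop.ne_top_iff_exists.1 h
    rw [sampled_of_eq_coe hs.symm]
    split_ifs
    · exact hC _ _
    · simpa

theorem abs_atTime_le {F : ℝ≥0 → Ω → ℝ} {C : ℝ} (hC : ∀ t ω, |F t ω| ≤ C)
    (τ : Ω → WithTop ℝ≥0) (ω : Ω) : |atTime F τ ω| ≤ C := by
  have hC0 : 0 ≤ C := (abs_nonneg _).trans (hC 0 ω)
  unfold atTime
  split_ifs
  · simpa
  · exact hC _ _

/-- The approach is from strictly above, so right-continuity of paths is all that the limits along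
the grid require. -/
theorem tendsto_gridPoint_floor (s : ℝ≥0) :
    Tendsto (fun n : ℕ => gridPoint n (⌊s * (n + 1)⌋₊ + 1)) atTop (𝓝[>] s) := by
  have hlt : ∀ n : ℕ, s < gridPoint n (⌊s * (n + 1)⌋₊ + 1) := fun n => by
    have hn : (0 : ℝ≥0) < n + 1 := by positivity
    rw [gridPoint, lt_div_iff₀ hn]
    push_cast
    exact Nat.lt_floor_add_one _
  refine tendsto_nhdsWithin_iff.2 ⟨?_, Eventually.of_forall hlt⟩
  have hup : ∀ n : ℕ, gridPoint n (⌊s * (n + 1)⌋₊ + 1) ≤ s + 1 / (n + 1 : ℝ≥0) := fun n => by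
    have hn : (0 : ℝ≥0) < n + 1 := by positivity
    rw [gridPoint, div_le_iff₀ hn, add_mul, div_mul_cancel₀ _ hn.ne']
    push_cast
    gcongr
    exact Nat.floor_le zero_le
  have hlim : Tendsto (fun n : ℕ => s + 1 / (n + 1 : ℝ≥0)) atTop (𝓝 s) := by
    have := (tendsto_one_div_add_atTop_nhds_zero_nat (𝕜 := ℝ≥0)).const_add s
    simpa using this
  exact tendsto_of_tendsto_of_tendsto_of_le_of_le tendsto_const_nhds hlim
    (fun n => (hlt n).le) hup

theorem tendsto_sampled {F : ℝ≥0 → Ω → ℝ} {ω : Ω}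
    (hF : ∀ t, ContinuousWithinAt (fun s => F s ω) (Set.Ici t) t) (τ : Ω → WithTop ℝ≥0) :
    Tendsto (fun n => sampled F τ n ω) atTop (𝓝 (atTime F τ ω)) := by
  rcases eq_or_ne (τ ω) ⊤ with h | h
  · simp [sampled_of_eq_top h, atTime, h]
  · obtain ⟨s, hs⟩ := WithTop.ne_top_iff_exists.1 h
    have h2 : atTime F τ ω = F s ω := by rw [atTime, if_neg h, ← hs, WithTop.untopD_coe]
    rw [h2]
    have h1 : Tendsto (fun n : ℕ => F (gridPoint n (⌊s * (n + 1)⌋₊ + 1)) ω) atTop (𝓝 (F s ω)) :=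
      (hF s).tendsto.comp ((tendsto_gridPoint_floor s).mono_right
        (nhdsWithin_mono _ Set.Ioi_subset_Ici_self))
    refine h1.congr' ?_
    -- The `(n + 1) ^ 2` cells of mesh `1 / (n + 1)` reach up to `n + 1`, so the cutoff eventually
    -- passes `s`.
    obtain ⟨N, hN⟩ := exists_nat_gt s
    filter_upwards [eventually_ge_atTop N] with n hn
    rw [sampled_of_eq_coe hs.symm, if_pos]
    rw [Nat.floor_lt zero_le]
    have : s < n + 1 := hN.trans_le (by exact_mod_cast hn.trans n.le_succ)
    push_cast
    rw [sq]
    have hn : (0 : ℝ≥0) < n + 1 := by positivity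
    exact mul_lt_mul_of_pos_right this hn

/-- Telescoping between the cells of `σ` and `τ`. The increment after `gridPoint n k` is weighted by
an event already known at that time, as the supermartingale inequality requires; the extra term on
the left accounts for `σ` before the horizon and `τ` not. -/
theorem sum_gridCell_sub_sum_gridCell (F : ℝ≥0 → Ω → ℝ) {σ τ : Ω → WithTop ℝ≥0} (hστ : σ ≤ τ)
    (n N : ℕ) (ω : Ω) :
    ∑ k ∈ Finset.range N, (gridCell τ n k).indicator (F (gridPoint n (k + 1))) ω -
      ∑ k ∈ Finset.range N, (gridCell σ n k).indicator (F (gridPoint n (k + 1))) ω +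
      {ω' | σ ω' < gridPoint n N ∧ (gridPoint n N : WithTop ℝ≥0) ≤ τ ω'}.indicator
        (F (gridPoint n N)) ω =
    ∑ k ∈ Finset.range N,
      {ω' | σ ω' < gridPoint n k ∧ (gridPoint n k : WithTop ℝ≥0) ≤ τ ω'}.indicator
        (fun ω' => F (gridPoint n (k + 1)) ω' - F (gridPoint n k) ω') ω := by
  classical
  induction N with
  | zero => simp [gridPoint]
  | succ N ih =>
    rw [Finset.sum_range_succ, Finset.sum_range_succ, Finset.sum_range_succ, ← ih]
    have h1 : (gridPoint n N : WithTop ℝ≥0) ≤ gridPoint n (N + 1) :=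
      WithTop.coe_le_coe.2 (gridPoint_mono n N.le_succ)
    have h2 := hστ ω
    simp only [Set.indicator_apply, gridCell, Set.mem_ofPred_eq]
    grind

variable [m : MeasurableSpace Ω] {𝓕 : Filtration ℝ≥0 m}

/-- Membership in a cell is decided only by its right end, which is why `F` is sampled there. -/
theorem _root_.MeasureTheory.IsStoppingTime.measurableSet_gridCell {τ : Ω → WithTop ℝ≥0}
    (hτ : IsStoppingTime 𝓕 τ) (n k : ℕ) :
    MeasurableSet[𝓕 (gridPoint n (k + 1))] (gridCell τ n k) :=
  (𝓕.mono (gridPoint_mono n k.le_succ) _ (hτ.measurableSet_ge _)).inter (hτ.measurableSet_lt _)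

theorem _root_.MeasureTheory.IsStoppingTime.measurable_sampled {F : ℝ≥0 → Ω → ℝ}
    (hF : ∀ t, Measurable (F t)) {τ : Ω → WithTop ℝ≥0} (hτ : IsStoppingTime 𝓕 τ) (n : ℕ) :
    Measurable (sampled F τ n) :=
  Finset.measurable_fun_sum _ fun k _ =>
    (hF _).indicator (𝓕.le _ _ (hτ.measurableSet_gridCell n k))

/-- A bounded process with right-continuous paths. -/
structure IsBoundedRightContinuous (F : ℝ≥0 → Ω → ℝ) : Prop where
  measurable : ∀ t, Measurable (F t)
  rightContinuous : ∀ ω t, ContinuousWithinAt (fun s => F s ω) (Set.Ici t) t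
  bounded : ∃ C, ∀ t ω, |F t ω| ≤ C

variable {F F' : ℝ≥0 → Ω → ℝ} {σ τ : Ω → WithTop ℝ≥0} {μ : Measure Ω} [IsFiniteMeasure μ]

namespace IsBoundedRightContinuous

theorem measurable_atTime (hF : IsBoundedRightContinuous F) (hτ : IsStoppingTime 𝓕 τ) :
    Measurable (atTime F τ) :=
  measurable_of_tendsto_metrizable (fun n => hτ.measurable_sampled hF.measurable n)
    (tendsto_pi_nhds.2 fun ω => tendsto_sampled (hF.rightContinuous ω) τ)

theorem integrable (hF : IsBoundedRightContinuous F) (t : ℝ≥0) : Integrable (F t) μ := by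
  obtain ⟨C, hC⟩ := hF.bounded
  exact Integrable.of_bound (hF.measurable t).aestronglyMeasurable C
    (Eventually.of_forall fun ω => hC t ω)

theorem integrable_atTime (hF : IsBoundedRightContinuous F) (hτ : IsStoppingTime 𝓕 τ) :
    Integrable (atTime F τ) μ := by
  obtain ⟨C, hC⟩ := hF.bounded
  exact Integrable.of_bound (hF.measurable_atTime hτ).aestronglyMeasurable C
    (Eventually.of_forall fun ω => abs_atTime_le hC τ ω)

theorem tendsto_integral_sampled (hF : IsBoundedRightContinuous F) (hτ : IsStoppingTime 𝓕 τ) :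
    Tendsto (fun n => ∫ ω, sampled F τ n ω ∂μ) atTop (𝓝 (∫ ω, atTime F τ ω ∂μ)) := by
  obtain ⟨C, hC⟩ := hF.bounded
  exact tendsto_integral_of_dominated_convergence (fun _ => C)
    (fun n => (hτ.measurable_sampled hF.measurable n).aestronglyMeasurable)
    (integrable_const C) (fun n => Eventually.of_forall fun ω => abs_sampled_le hC τ n ω)
    (Eventually.of_forall fun ω => tendsto_sampled (hF.rightContinuous ω) τ)

theorem integrable_sampled (hF : IsBoundedRightContinuous F) (hτ : IsStoppingTime 𝓕 τ) (n : ℕ) :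
    Integrable (sampled F τ n) μ := by
  obtain ⟨C, hC⟩ := hF.bounded
  exact Integrable.of_bound (hτ.measurable_sampled hF.measurable n).aestronglyMeasurable C
    (Eventually.of_forall fun ω => abs_sampled_le hC τ n ω)

theorem integral_sampled (hF : IsBoundedRightContinuous F) (hτ : IsStoppingTime 𝓕 τ) (n : ℕ) :
    ∫ ω, sampled F τ n ω ∂μ = ∑ k ∈ Finset.range ((n + 1) ^ 2),
      ∫ ω in gridCell τ n k, F (gridPoint n (k + 1)) ω ∂μ := by
  have hc := fun k => 𝓕.le _ _ (hτ.measurableSet_gridCell n k)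
  simp only [sampled]
  rw [integral_finsetSum _ fun k _ => (hF.integrable _).indicator (hc k)]
  exact Finset.sum_congr rfl fun k _ => integral_indicator (hc k)

/-- Processes with equal conditional expectations at fixed times have equal expectations at
stopping times. -/
theorem integral_atTime_congr (hF : IsBoundedRightContinuous F)
    (hF' : IsBoundedRightContinuous F') (hτ : IsStoppingTime 𝓕 τ)
    (h : ∀ t A, MeasurableSet[𝓕 t] A → ∫ ω in A, F t ω ∂μ = ∫ ω in A, F' t ω ∂μ) :
    ∫ ω, atTime F τ ω ∂μ = ∫ ω, atTime F' τ ω ∂μ := by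
  refine tendsto_nhds_unique (hF.tendsto_integral_sampled hτ) ?_
  refine (hF'.tendsto_integral_sampled hτ).congr fun n => ?_
  rw [hF.integral_sampled hτ, hF'.integral_sampled hτ]
  exact Finset.sum_congr rfl fun k _ => (h _ _ (hτ.measurableSet_gridCell n k)).symm

end IsBoundedRightContinuous

/-- Optional stopping for nonnegative supermartingales with bounded right-continuous paths. -/
theorem IsBoundedRightContinuous.integral_atTime_le (hF : IsBoundedRightContinuous F)
    (hF0 : ∀ t ω, 0 ≤ F t ω) (hσ : IsStoppingTime 𝓕 σ) (hτ : IsStoppingTime 𝓕 τ) (hστ : σ ≤ τ)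
    (h : ∀ s t, s ≤ t → ∀ A, MeasurableSet[𝓕 s] A → ∫ ω in A, F t ω ∂μ ≤ ∫ ω in A, F s ω ∂μ) :
    ∫ ω, atTime F τ ω ∂μ ≤ ∫ ω, atTime F σ ω ∂μ := by
  refine le_of_tendsto_of_tendsto' (hF.tendsto_integral_sampled hτ)
    (hF.tendsto_integral_sampled hσ) fun n => ?_
  rw [← sub_nonpos, ← integral_sub (hF.integrable_sampled hτ n) (hF.integrable_sampled hσ n)]
  set B : ℕ → Set Ω := fun k =>
    {ω' | σ ω' < gridPoint n k ∧ (gridPoint n k : WithTop ℝ≥0) ≤ τ ω'}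
  have hB : ∀ k, MeasurableSet[𝓕 (gridPoint n k)] (B k) := fun k =>
    (hσ.measurableSet_lt _).inter (hτ.measurableSet_ge _)
  have hB' : ∀ k, MeasurableSet (B k) := fun k => 𝓕.le _ _ (hB k)
  have hint : ∀ k, Integrable (fun ω => F (gridPoint n (k + 1)) ω - F (gridPoint n k) ω) μ :=
    fun k => (hF.integrable _).sub (hF.integrable _)
  calc ∫ ω, (sampled F τ n ω - sampled F σ n ω) ∂μ
      ≤ ∫ ω, ∑ k ∈ Finset.range ((n + 1) ^ 2), (B k).indicator
          (fun ω' => F (gridPoint n (k + 1)) ω' - F (gridPoint n k) ω') ω ∂μ := by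
        refine integral_mono ((hF.integrable_sampled hτ n).sub (hF.integrable_sampled hσ n))
          (integrable_finsetSum _ fun k _ => (hint k).indicator (hB' k)) fun ω => ?_
        have := sum_gridCell_sub_sum_gridCell F hστ n ((n + 1) ^ 2) ω
        -- The horizon term is dropped, which uses `0 ≤ F`.
        have h0 := Set.indicator_nonneg (s := B ((n + 1) ^ 2))
          (fun ω' _ => hF0 (gridPoint n ((n + 1) ^ 2)) ω') ω
        simp only [sampled, B] at this h0 ⊢
        linarith
    _ = ∑ k ∈ Finset.range ((n + 1) ^ 2),
          ∫ ω in B k, (F (gridPoint n (k + 1)) ω - F (gridPoint n k) ω) ∂μ := by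
        rw [integral_finsetSum _ fun k _ => (hint k).indicator (hB' k)]
        exact Finset.sum_congr rfl fun k _ => integral_indicator (hB' k)
    _ ≤ 0 := by
        refine Finset.sum_nonpos fun k _ => ?_
        rw [integral_sub (hF.integrable _).integrableOn (hF.integrable _).integrableOn, sub_nonpos]
        exact h _ _ (gridPoint_mono n k.le_succ) _ (hB k)

end StoppedExpectations

/-! ### Stopping times of a filtration without right-continuity -/

section NaturalStoppingTimes

open Filter Topology

variable {Ω : Type*} {S : Finset ℝ} {Y : ℝ≥0 → Ω → S}

theorem eventually_eq_of_continuousWithinAt {ω : Ω} {t : ℝ≥0}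
    (h : ContinuousWithinAt (fun s => Y s ω) (Set.Ici t) t) :
    ∀ᶠ s in 𝓝[≥] t, Y s ω = Y t ω :=
  h.eventually ((isOpen_discrete {Y t ω}).mem_nhds rfl)

/-- The random time `σ` restricted to the event that `Y` is in `B` at that time, and `⊤` off that
event. -/
noncomputable def restrictTime (Y : ℝ≥0 → Ω → S) (σ : Ω → WithTop ℝ≥0) (B : S → Prop)
    (ω : Ω) : WithTop ℝ≥0 :=
  open Classical in if B (Y ((σ ω).untopD 0) ω) then σ ω else ⊤

/-- The current excursion of the path below `L` has lasted for `D` at time `t`. -/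
def IsLongBelow (L : ℝ) (D : ℝ≥0) (Y : ℝ≥0 → Ω → S) (t : ℝ≥0) (ω : Ω) : Prop :=
  D ≤ t ∧ ∀ u, t < u + D → u ≤ t → (Y u ω : ℝ) < L

/-- Removes the supremum. The conjunct `D ≤ t` comes from the convention `sSup ∅ = 0`. -/
theorem le_sub_lastAbove_iff {L : ℝ} {D t : ℝ≥0} {ω : Ω} :
    D ≤ t - lastAbove L Y t ω ↔ IsLongBelow L D Y t ω := by
  have hbdd : BddAbove {s : ℝ≥0 | s ≤ t ∧ L ≤ (Y s ω : ℝ)} := ⟨t, fun s hs => hs.1⟩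
  have hle : lastAbove L Y t ω ≤ t := csSup_le' fun s hs => hs.1
  rw [le_tsub_iff_right hle]
  constructor
  · refine fun h => ⟨le_self_add.trans h, fun u hu hut => ?_⟩
    by_contra! hL
    have h1 : u ≤ lastAbove L Y t ω := le_csSup hbdd ⟨hut, hL⟩
    have h2 : D + u ≤ t := (add_le_add le_rfl h1).trans h
    rw [add_comm] at h2
    exact absurd hu h2.not_gt
  · rintro ⟨hD, h⟩
    have h1 : lastAbove L Y t ω ≤ t - D := csSup_le' fun u hu => by
      by_contra! hlt
      exact absurd (h u ((tsub_lt_iff_right hD).1 hlt) hu.1) (not_lt.2 hu.2)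
    rw [add_comm]
    exact (le_tsub_iff_right hD).1 h1

/-- The infimum is attained: the constraint `t < u + D` is strict, so each `u` to be checked at the
infimum is already covered by some nearby time of the set. -/
theorem parisianTime_le_iff {L : ℝ} {D t : ℝ≥0} {ω : Ω} :
    parisianTime L D Y ω ≤ t ↔ ∃ s ≤ t, IsLongBelow L D Y s ω := by
  have hset : parisianTime L D Y ω =
      sInf ((fun t : ℝ≥0 => (t : WithTop ℝ≥0)) '' {s | IsLongBelow L D Y s ω}) := by
    simp only [parisianTime, le_sub_lastAbove_iff]
  rw [hset]
  rcases Set.eq_empty_or_nonempty {s | IsLongBelow L D Y s ω} with h | h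
  · rw [h, Set.image_empty, WithTop.sInf_empty]
    simp only [Set.eq_empty_iff_forall_notMem, Set.mem_ofPred_eq] at h
    simp only [h, and_false, exists_false, top_le_iff, WithTop.coe_ne_top]
  · have hleast : IsLeast {s | IsLongBelow L D Y s ω} (sInf {s | IsLongBelow L D Y s ω}) := by
      refine ⟨⟨le_csInf h fun s hs => hs.1, fun u hu hut => ?_⟩, fun s hs => csInf_le' hs⟩
      obtain ⟨s, hs, hsu⟩ := exists_lt_of_csInf_lt h hu
      exact hs.2 u hsu (hut.trans (csInf_le' hs))
    have himg := WithTop.coe_mono.map_isLeast hleast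
    rw [himg.csInf_eq, WithTop.coe_le_coe]
    exact ⟨fun hle => ⟨_, hle, hleast.1⟩, fun ⟨s, hst, hs⟩ => (hleast.2 hs).trans hst⟩

/-- The value at `u < t` recurs at a point of `C` just after `u`; only `u = t` has to be kept
separately. -/
theorem isLongBelow_iff_forall_mem {C : Set ℝ≥0} (hC : Dense C) {L : ℝ} {D t : ℝ≥0} {ω : Ω}
    (hr : ∀ t, ContinuousWithinAt (fun s => Y s ω) (Set.Ici t) t) :
    IsLongBelow L D Y t ω ↔
      D ≤ t ∧ ∀ u ∈ insert t C, t < u + D → u ≤ t → (Y u ω : ℝ) < L := by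
  refine and_congr_right fun _ => ⟨fun h u _ => h u, fun h u hu hut => ?_⟩
  rcases hut.eq_or_lt with rfl | hlt
  · exact h u (Set.mem_insert _ _) hu le_rfl
  obtain ⟨v, hv, hvsub⟩ := mem_nhdsGE_iff_exists_Ico_subset.1
    (eventually_eq_of_continuousWithinAt (hr u))
  obtain ⟨q, hqC, hq1, hq2⟩ := hC.exists_between (lt_min hv hlt)
  have h1 : Y q ω = Y u ω := hvsub ⟨hq1.le, hq2.trans_le (min_le_left _ _)⟩
  rw [← h1]
  exact h q (Set.mem_insert_of_mem _ hqC) (hu.trans_le (by gcongr))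
    (hq2.le.trans (min_le_right _ _))

/-- A long excursion at `s < t` is still in progress shortly after `s`, hence at a point of `C`. -/
theorem exists_isLongBelow_iff_exists_mem {C : Set ℝ≥0} (hC : Dense C) {L : ℝ} {D t : ℝ≥0} {ω : Ω}
    (hr : ∀ t, ContinuousWithinAt (fun s => Y s ω) (Set.Ici t) t) :
    (∃ s ≤ t, IsLongBelow L D Y s ω) ↔ ∃ s ∈ insert t C, s ≤ t ∧ IsLongBelow L D Y s ω := by
  refine ⟨fun ⟨s, hst, hs⟩ => ?_, fun ⟨s, _, h⟩ => ⟨s, h⟩⟩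
  rcases hst.eq_or_lt with rfl | hlt
  · exact ⟨s, Set.mem_insert _ _, le_rfl, hs⟩
  -- For `D = 0` the path may be above `L` at `s`, but then the condition is vacuous at every time.
  rcases eq_zero_or_pos D with rfl | hD
  · refine ⟨t, Set.mem_insert _ _, le_rfl, zero_le, fun u hu hut => ?_⟩
    rw [add_zero] at hu
    exact absurd hut hu.not_ge
  obtain ⟨v, hv, hvsub⟩ := mem_nhdsGE_iff_exists_Ico_subset.1
    (eventually_eq_of_continuousWithinAt (hr s))
  obtain ⟨q, hqC, hq1, hq2⟩ := hC.exists_between (lt_min hv hlt)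
  refine ⟨q, Set.mem_insert_of_mem _ hqC, hq2.le.trans (min_le_right _ _), hs.1.trans hq1.le,
    fun u hu huq => ?_⟩
  rcases le_total u s with hus | hsu
  · exact hs.2 u (hq1.trans hu) hus
  · have h1 : Y u ω = Y s ω := hvsub ⟨hsu, huq.trans_lt (hq2.trans_le (min_le_left _ _))⟩
    rw [h1]
    exact hs.2 s (lt_add_of_pos_right s hD) le_rfl

variable [m : MeasurableSpace Ω] {𝓕 : Filtration ℝ≥0 m} {σ : Ω → WithTop ℝ≥0}

theorem isStoppingTime_parisianTime (hY : ∀ t (B : Set S), MeasurableSet[𝓕 t] (Y t ⁻¹' B))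
    (hr : ∀ ω t, ContinuousWithinAt (fun s => Y s ω) (Set.Ici t) t) (L : ℝ) (D : ℝ≥0) :
    IsStoppingTime 𝓕 (parisianTime L D Y) := by
  intro t
  obtain ⟨C, hCc, hC⟩ := TopologicalSpace.exists_countable_dense ℝ≥0
  have hlong : ∀ s, MeasurableSet[𝓕 s] {ω | IsLongBelow L D Y s ω} := fun s => by
    have : {ω | IsLongBelow L D Y s ω} =
        {_ω | D ≤ s} ∩ ⋂ u ∈ insert s C, {ω | s < u + D → u ≤ s → (Y u ω : ℝ) < L} := by
      ext ω
      simp only [Set.mem_inter_iff, Set.mem_iInter, Set.mem_ofPred_eq,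
        isLongBelow_iff_forall_mem hC (hr ω)]
    rw [this]
    refine (MeasurableSet.const _).inter
      (MeasurableSet.biInter (hCc.insert s) fun u _ => ?_)
    by_cases h : s < u + D ∧ u ≤ s
    · simp only [h.1, h.2, true_imp_iff]
      exact 𝓕.mono h.2 _ (hY u {y | (y : ℝ) < L})
    · convert @MeasurableSet.univ Ω (𝓕 s)
      ext ω
      simp only [Set.mem_ofPred_eq, Set.mem_univ, iff_true]
      exact fun h1 h2 => absurd ⟨h1, h2⟩ h
  have : {ω | parisianTime L D Y ω ≤ t} =
      ⋃ s ∈ insert t C, {ω | s ≤ t ∧ IsLongBelow L D Y s ω} := by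
    ext ω
    simp only [Set.mem_iUnion, Set.mem_ofPred_eq, parisianTime_le_iff,
      exists_isLongBelow_iff_exists_mem hC (hr ω), exists_prop]
  rw [this]
  refine MeasurableSet.biUnion (hCc.insert t) fun s _ => ?_
  by_cases h : s ≤ t
  · simp only [h, true_and]
    exact 𝓕.mono h _ (hlong s)
  · simp only [h, false_and]
    exact MeasurableSet.const _

/-- Either `σ = t` and `Y t` is inspected directly, or `σ < t` and the state at `σ` is read off at
grid points in `(σ, t]`, where the path eventually has the same value. -/
theorem isStoppingTime_restrictTime (hY : ∀ t (B : Set S), MeasurableSet[𝓕 t] (Y t ⁻¹' B))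
    (hr : ∀ ω t, ContinuousWithinAt (fun s => Y s ω) (Set.Ici t) t)
    (hσ : IsStoppingTime 𝓕 σ) (B : S → Prop) : IsStoppingTime 𝓕 (restrictTime Y σ B) := by
  intro t
  have : {ω | restrictTime Y σ B ω ≤ t} = ({ω | σ ω = t} ∩ Y t ⁻¹' {y | B y}) ∪
      ⋃ N : ℕ, ⋂ n : ℕ, ⋂ _ : N ≤ n, ⋃ k : ℕ, ⋃ _ : gridPoint n (k + 1) ≤ t,
        gridCell σ n k ∩ Y (gridPoint n (k + 1)) ⁻¹' {y | B y} := by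
    ext ω
    simp only [Set.mem_union, Set.mem_inter_iff, Set.mem_iUnion, Set.mem_iInter,
      Set.mem_ofPred_eq, Set.mem_preimage, exists_prop, restrictTime]
    rcases eq_or_ne (σ ω) ⊤ with h | h
    · have hc : ∀ n k, ω ∉ gridCell σ n k := fun n k hk => by
        simp only [gridCell, Set.mem_ofPred_eq, h] at hk
        exact not_top_lt hk.2
      simp only [h, hc, false_and, and_false, exists_false, ite_self]
      simp only [top_le_iff, WithTop.coe_ne_top, WithTop.top_ne_coe, false_and, false_or, false_iff]
      rintro ⟨N, hN⟩
      exact hN N le_rfl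
    obtain ⟨s, hs⟩ := WithTop.ne_top_iff_exists.1 h
    have hev : ∀ᶠ n : ℕ in atTop, Y (gridPoint n (⌊s * (n + 1)⌋₊ + 1)) ω = Y s ω :=
      (tendsto_gridPoint_floor s).eventually
        (nhdsWithin_mono _ Set.Ioi_subset_Ici_self (eventually_eq_of_continuousWithinAt (hr ω s)))
    have hcell := mem_gridCell_iff hs.symm
    have hcond : (∃ N : ℕ, ∀ n, N ≤ n → ∃ k, gridPoint n (k + 1) ≤ t ∧ ω ∈ gridCell σ n k ∧
        B (Y (gridPoint n (k + 1)) ω)) ↔ s < t ∧ B (Y s ω) := by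
      simp only [hcell]
      rw [← eventually_atTop (p := fun n : ℕ => ∃ k, gridPoint n (k + 1) ≤ t ∧
        k = ⌊s * (n + 1)⌋₊ ∧ B (Y (gridPoint n (k + 1)) ω))]
      constructor
      · intro hall
        obtain ⟨n, ⟨k, hk, hkn, hB⟩, hn⟩ := (hall.and hev).exists
        have hlt := ((hcell n k).2 hkn).2
        rw [← hs, WithTop.coe_lt_coe] at hlt
        subst hkn
        exact ⟨hlt.trans_le hk, hn ▸ hB⟩
      · rintro ⟨hst, hB⟩
        have hle := (tendsto_gridPoint_floor s).eventually
          (nhdsWithin_le_nhds (eventually_le_nhds hst))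
        filter_upwards [hev, hle] with n hn hle
        exact ⟨_, hle, rfl, hn ▸ hB⟩
    rw [hcond, ← hs, WithTop.untopD_coe]
    by_cases hB : B (Y s ω)
    · simp only [hB, if_true, WithTop.coe_le_coe, WithTop.coe_inj, and_true]
      rw [le_iff_eq_or_lt]
      refine or_congr_left ⟨fun h => ⟨h, h ▸ hB⟩, fun h => h.1⟩
    · simp only [hB, if_false, top_le_iff, WithTop.coe_ne_top, WithTop.coe_inj, and_false, or_false,
        false_iff]
      rintro ⟨rfl, hB'⟩
      exact hB hB'
  rw [this]
  refine ((hσ.measurableSet_eq t).inter (hY t _)).union (MeasurableSet.iUnion fun N =>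
    MeasurableSet.iInter fun n => MeasurableSet.iInter fun _ => MeasurableSet.iUnion fun k =>
      MeasurableSet.iUnion fun hk => 𝓕.mono hk _ ((hσ.measurableSet_gridCell n k).inter (hY _ _)))

theorem isStoppingTime_add_const (hσ : IsStoppingTime 𝓕 σ) (h : ℝ≥0) :
    IsStoppingTime 𝓕 (fun ω => σ ω + h) := by
  intro t
  by_cases ht : h ≤ t
  · have : {ω | σ ω + h ≤ t} = {ω | σ ω ≤ ((t - h : ℝ≥0) : WithTop ℝ≥0)} := by
      ext ω
      simp only [Set.mem_ofPred_eq]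
      cases σ ω with
      | top => simp only [WithTop.top_add, top_le_iff, WithTop.coe_ne_top]
      | coe s => norm_cast; exact (le_tsub_iff_right ht).symm
    rw [this]
    exact 𝓕.mono tsub_le_self _ (hσ _)
  · convert @MeasurableSet.empty Ω (𝓕 t)
    ext ω
    simp only [Set.mem_ofPred_eq, Set.mem_empty_iff_false, iff_false]
    cases σ ω with
    | top => simp only [WithTop.top_add, top_le_iff, WithTop.coe_ne_top, not_false_eq_true]
    | coe s => norm_cast; exact fun h' => ht (le_add_self.trans h')

end NaturalStoppingTimes

/-! ### Discounted values, the Markov property and the two prices -/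

section Pricing

open Filter Topology

variable {Ω : Type*} {S : Finset ℝ} {Y : ℝ≥0 → Ω → S}

theorem restrictTime_of_pos {σ : Ω → WithTop ℝ≥0} {B : S → Prop} {ω : Ω}
    (h : B (Y ((σ ω).untopD 0) ω)) : restrictTime Y σ B ω = σ ω := if_pos h

theorem restrictTime_of_neg {σ : Ω → WithTop ℝ≥0} {B : S → Prop} {ω : Ω}
    (h : ¬ B (Y ((σ ω).untopD 0) ω)) : restrictTime Y σ B ω = ⊤ := if_neg h

theorem discounted_congr {r : ℝ} {φ : S → ℝ} {σ τ : Ω → WithTop ℝ≥0} {ω : Ω} (h : σ ω = τ ω) :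
    discounted r φ Y σ ω = discounted r φ Y τ ω := by
  unfold discounted; rw [h]

theorem discounted_of_eq_top {r : ℝ} {φ : S → ℝ} {τ : Ω → WithTop ℝ≥0} {ω : Ω} (h : τ ω = ⊤) :
    discounted r φ Y τ ω = 0 := if_pos h

theorem discounted_restrictTime (r : ℝ) (φ : S → ℝ) (σ : Ω → WithTop ℝ≥0) (B : S → Prop)
    [DecidablePred B] (ω : Ω) :
    discounted r φ Y (restrictTime Y σ B) ω =
      discounted r (fun y => if B y then φ y else 0) Y σ ω := by
  by_cases h : B (Y ((σ ω).untopD 0) ω)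
  · rw [discounted_congr (restrictTime_of_pos h)]
    simp only [discounted, h, if_true]
  · rw [discounted_of_eq_top (restrictTime_of_neg h)]
    simp only [discounted, h, if_false, mul_zero, ite_self]

theorem discounted_mono {r : ℝ} {φ ψ : S → ℝ} (h : ∀ y, φ y ≤ ψ y) (τ : Ω → WithTop ℝ≥0) (ω : Ω) :
    discounted r φ Y τ ω ≤ discounted r ψ Y τ ω := by
  unfold discounted
  split_ifs
  · exact le_rfl
  · exact mul_le_mul_of_nonneg_left (h _) (Real.exp_nonneg _)

theorem discounted_nonneg {r : ℝ} {φ : S → ℝ} (h : ∀ y, 0 ≤ φ y) (τ : Ω → WithTop ℝ≥0) (ω : Ω) :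
    0 ≤ discounted r φ Y τ ω := by
  unfold discounted
  split_ifs
  · exact le_rfl
  · exact mul_nonneg (Real.exp_nonneg _) (h _)

theorem exp_neg_mul_le_one {r : ℝ} (hr : 0 ≤ r) (t : ℝ≥0) : Real.exp (-r * t) ≤ 1 :=
  Real.exp_le_one_iff.2 (mul_nonpos_of_nonpos_of_nonneg (neg_nonpos.2 hr) t.2)

theorem discounted_add_const_le {r : ℝ} (hr : 0 ≤ r) {φ ψ : S → ℝ} {ε : ℝ} (hε : 0 ≤ ε)
    (h : ∀ y, φ y ≤ ψ y + ε) (τ : Ω → WithTop ℝ≥0) (ω : Ω) :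
    discounted r φ Y τ ω ≤ discounted r ψ Y τ ω + ε := by
  unfold discounted
  split_ifs
  · simpa
  · have h1 := exp_neg_mul_le_one hr ((τ ω).untopD 0)
    have h2 := mul_le_mul_of_nonneg_left (h (Y ((τ ω).untopD 0) ω))
      (Real.exp_nonneg (-r * ((τ ω).untopD 0 : ℝ≥0)))
    nlinarith

theorem discounted_eq_sum_activation (r L : ℝ) (D : ℝ≥0) (φ : S → ℝ) (ω : Ω) :
    discounted r φ Y (parisianTime L D Y) ω = ∑ y, activation r L D Y y ω * φ y := by
  classical
  unfold activation discounted
  split_ifs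
  · simp
  · simp [Set.indicator_apply, Set.mem_singleton_iff]

variable [MeasurableSpace Ω] {G : Matrix S S ℝ} {P : S → Measure Ω}

/-- The expected discounted value after time `h` of `φ (Y)`, as a function of the initial state. -/
noncomputable def discountedSemigroup (r : ℝ) (Y : ℝ≥0 → Ω → S) (P : S → Measure Ω) (h : ℝ≥0)
    (φ : S → ℝ) (y : S) : ℝ :=
  Real.exp (-r * h) * ∫ ω, φ (Y h ω) ∂(P y)

namespace IsCTMC

theorem measurableSet_preimage (hY : IsCTMC G Y P) (t : ℝ≥0) (B : Set S) :
    MeasurableSet[Filtration.natural Y hY.stronglyMeasurable t] (Y t ⁻¹' B) :=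
  ((Filtration.stronglyAdapted_natural hY.stronglyMeasurable) t).measurable
    B.toFinite.measurableSet

theorem measurable_comp (hY : IsCTMC G Y P) (φ : S → ℝ) (t : ℝ≥0) :
    Measurable fun ω => φ (Y t ω) :=
  (measurable_of_finite φ).comp (hY.stronglyMeasurable t).measurable

theorem isBoundedRightContinuous (hY : IsCTMC G Y P) {r : ℝ} (hr : 0 ≤ r) (φ : S → ℝ) (h : ℝ≥0) :
    IsBoundedRightContinuous
      (fun t ω => Real.exp (-r * (t + h : ℝ≥0)) * φ (Y (t + h) ω)) where
  measurable t := (hY.measurable_comp φ _).const_mul _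
  rightContinuous ω t := by
    refine ContinuousWithinAt.mul (Continuous.continuousWithinAt (by fun_prop)) ?_
    have h1 : ContinuousWithinAt (fun s => s + h) (Set.Ici t) t :=
      Continuous.continuousWithinAt (by fun_prop)
    have h2 : ContinuousWithinAt (fun s => Y (s + h) ω) (Set.Ici t) t :=
      (hY.rightContinuous ω (t + h)).comp (f := fun s => s + h) h1 fun s (hs : t ≤ s) =>
        show t + h ≤ s + h by gcongr
    exact (continuous_of_discreteTopology (f := φ)).continuousAt.comp_continuousWithinAt h2
  bounded := by
    refine ⟨∑ y, |φ y|, fun t ω => ?_⟩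
    rw [abs_mul, abs_of_nonneg (Real.exp_nonneg _)]
    refine (mul_le_of_le_one_left (abs_nonneg _) (exp_neg_mul_le_one hr _)).trans ?_
    exact Finset.single_le_sum (f := fun y => |φ y|) (fun _ _ => abs_nonneg _) (Finset.mem_univ _)

theorem isBoundedRightContinuous_zero (hY : IsCTMC G Y P) {r : ℝ} (hr : 0 ≤ r) (φ : S → ℝ) :
    IsBoundedRightContinuous (fun t ω => Real.exp (-r * t) * φ (Y t ω)) := by
  simpa using hY.isBoundedRightContinuous hr φ 0

theorem integrable_discounted (hY : IsCTMC G Y P) {r : ℝ} (hr : 0 ≤ r) (φ : S → ℝ)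
    {τ : Ω → WithTop ℝ≥0} (hτ : IsStoppingTime (Filtration.natural Y hY.stronglyMeasurable) τ)
    (x : S) : Integrable (discounted r φ Y τ) (P x) :=
  have := hY.isProbabilityMeasure x
  (hY.isBoundedRightContinuous_zero hr φ).integrable_atTime hτ

theorem integrable_comp (hY : IsCTMC G Y P) (φ : S → ℝ) (t : ℝ≥0) (x : S) :
    Integrable (fun ω => φ (Y t ω)) (P x) := by
  have := hY.isProbabilityMeasure x
  simpa using (hY.isBoundedRightContinuous_zero le_rfl φ).integrable (μ := P x) t

theorem setIntegral_indicator (hY : IsCTMC G Y P) (x y : S) (s t : ℝ≥0) {A : Set Ω}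
    (hA : MeasurableSet[Filtration.natural Y hY.stronglyMeasurable s] A) :
    ∫ ω in A, (Y (s + t) ⁻¹' {y}).indicator (fun _ => (1 : ℝ)) ω ∂(P x) =
      ∫ ω in A, NormedSpace.exp ((t : ℝ) • G) (Y s ω) y ∂(P x) := by
  have := hY.isProbabilityMeasure x
  have hle := (Filtration.natural Y hY.stronglyMeasurable).le s
  rw [← setIntegral_condExp hle ((integrable_const (1 : ℝ)).indicator
    ((hY.stronglyMeasurable _).measurable (measurableSet_singleton y))) hA]
  exact setIntegral_congr_ae (hle _ hA) ((hY.markov x y s t).mono fun ω h _ => h)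

theorem integral_comp_zero (hY : IsCTMC G Y P) (φ : S → ℝ) (x : S) :
    ∫ ω, φ (Y 0 ω) ∂(P x) = φ x := by
  have := hY.isProbabilityMeasure x
  rw [integral_congr_ae ((hY.initial x).mono fun ω h => show φ (Y 0 ω) = φ x by rw [h])]
  simp

theorem setIntegral_comp_add_eq_sum (hY : IsCTMC G Y P) (φ : S → ℝ) (x : S) (s t : ℝ≥0)
    {A : Set Ω} (hA : MeasurableSet[Filtration.natural Y hY.stronglyMeasurable s] A) :
    ∫ ω in A, φ (Y (s + t) ω) ∂(P x) =
      ∫ ω in A, ∑ y, φ y * NormedSpace.exp ((t : ℝ) • G) (Y s ω) y ∂(P x) := by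
  classical
  have := hY.isProbabilityMeasure x
  have h1 : ∀ ω, φ (Y (s + t) ω) =
      ∑ y, φ y * (Y (s + t) ⁻¹' {y}).indicator (fun _ => (1 : ℝ)) ω := fun ω => by
    simp [Set.indicator_apply]
  simp only [h1]
  rw [integral_finsetSum, integral_finsetSum]
  · refine Finset.sum_congr rfl fun y _ => ?_
    rw [integral_const_mul, integral_const_mul, hY.setIntegral_indicator x y s t hA]
  · exact fun y _ => ((hY.integrable_comp (fun z => NormedSpace.exp ((t : ℝ) • G) z y) s x).const_mul
      _).integrableOn
  · exact fun y _ => (((integrable_const (1 : ℝ)).indicator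
      ((hY.stronglyMeasurable _).measurable (measurableSet_singleton y))).const_mul _).integrableOn

/-- The Markov property at a fixed time. -/
theorem setIntegral_comp_add (hY : IsCTMC G Y P) (φ : S → ℝ) (x : S) (s t : ℝ≥0)
    {A : Set Ω} (hA : MeasurableSet[Filtration.natural Y hY.stronglyMeasurable s] A) :
    ∫ ω in A, φ (Y (s + t) ω) ∂(P x) = ∫ ω in A, ∫ ω', φ (Y t ω') ∂(P (Y s ω)) ∂(P x) := by
  -- Conditioning at time `0`, where the state is `z` almost surely, identifies the row of the
  -- exponential with the law of `Y t` under `P z`.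
  have h : ∀ z, ∫ ω', φ (Y t ω') ∂(P z) = ∑ y, φ y * NormedSpace.exp ((t : ℝ) • G) z y := fun z => by
    have h1 := hY.setIntegral_comp_add_eq_sum φ z 0 t MeasurableSet.univ
    simp only [zero_add, setIntegral_univ] at h1
    rw [h1, hY.integral_comp_zero (fun w => ∑ y, φ y * NormedSpace.exp ((t : ℝ) • G) w y)]
  simp only [h]
  exact hY.setIntegral_comp_add_eq_sum φ x s t hA

theorem setIntegral_discounted_add (hY : IsCTMC G Y P) (r : ℝ) (φ : S → ℝ) (x : S) (s h : ℝ≥0)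
    {A : Set Ω} (hA : MeasurableSet[Filtration.natural Y hY.stronglyMeasurable s] A) :
    ∫ ω in A, Real.exp (-r * (s + h : ℝ≥0)) * φ (Y (s + h) ω) ∂(P x) =
      ∫ ω in A, Real.exp (-r * s) * discountedSemigroup r Y P h φ (Y s ω) ∂(P x) := by
  have h1 : Real.exp (-r * (s + h : ℝ≥0)) = Real.exp (-r * s) * Real.exp (-r * h) := by
    rw [← Real.exp_add, NNReal.coe_add, mul_add]
  simp only [discountedSemigroup]
  rw [integral_const_mul, integral_const_mul, integral_const_mul,
    hY.setIntegral_comp_add φ x s h hA, h1, mul_assoc]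

/-- The strong Markov property. -/
theorem integral_discounted_add (hY : IsCTMC G Y P) {r : ℝ} (hr : 0 ≤ r) (φ : S → ℝ)
    {σ : Ω → WithTop ℝ≥0} (hσ : IsStoppingTime (Filtration.natural Y hY.stronglyMeasurable) σ)
    (x : S) (h : ℝ≥0) :
    ∫ ω, discounted r φ Y (fun ω => σ ω + h) ω ∂(P x) =
      ∫ ω, discounted r (discountedSemigroup r Y P h φ) Y σ ω ∂(P x) := by
  have := hY.isProbabilityMeasure x
  have h1 : ∀ ω, discounted r φ Y (fun ω => σ ω + h) ω =
      atTime (fun t ω => Real.exp (-r * (t + h : ℝ≥0)) * φ (Y (t + h) ω)) σ ω := fun ω => by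
    rcases eq_or_ne (σ ω) ⊤ with hs | hs
    · simp only [discounted, atTime, hs, WithTop.top_add, if_true]
    · obtain ⟨s, hs⟩ := WithTop.ne_top_iff_exists.1 hs
      simp only [discounted, atTime, ← hs, ← WithTop.coe_add, WithTop.coe_ne_top, if_false,
        WithTop.untopD_coe]
  simp only [h1]
  exact (hY.isBoundedRightContinuous hr φ h).integral_atTime_congr
    (hY.isBoundedRightContinuous_zero hr _) hσ
    fun t A hA => hY.setIntegral_discounted_add r φ x t h hA

/-- For an excessive `φ` the discounted process is a nonnegative supermartingale, so optional
stopping applies. -/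
theorem integral_discounted_le (hY : IsCTMC G Y P) {r : ℝ} (hr : 0 ≤ r) {φ : S → ℝ}
    (hφ : ∀ y, 0 ≤ φ y) (hsuper : ∀ h y, discountedSemigroup r Y P h φ y ≤ φ y)
    {σ τ : Ω → WithTop ℝ≥0} (hσ : IsStoppingTime (Filtration.natural Y hY.stronglyMeasurable) σ)
    (hτ : IsStoppingTime (Filtration.natural Y hY.stronglyMeasurable) τ) (hστ : σ ≤ τ) (x : S) :
    ∫ ω, discounted r φ Y τ ω ∂(P x) ≤ ∫ ω, discounted r φ Y σ ω ∂(P x) := by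
  have := hY.isProbabilityMeasure x
  refine (hY.isBoundedRightContinuous_zero hr φ).integral_atTime_le
    (fun t ω => mul_nonneg (Real.exp_nonneg _) (hφ _)) hσ hτ hστ fun s t hst A hA => ?_
  obtain ⟨h, rfl⟩ := exists_add_of_le hst
  rw [hY.setIntegral_discounted_add r φ x s h hA]
  exact setIntegral_mono ((hY.isBoundedRightContinuous_zero hr _).integrable s).integrableOn
    ((hY.isBoundedRightContinuous_zero hr _).integrable s).integrableOn
    fun ω => mul_le_mul_of_nonneg_left (hsuper _ _) (Real.exp_nonneg _)

theorem integral_discounted_zero (hY : IsCTMC G Y P) (r : ℝ) (φ : S → ℝ) (x : S) :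
    ∫ ω, discounted r φ Y (fun _ => ((0 : ℝ≥0) : WithTop ℝ≥0)) ω ∂(P x) = φ x := by
  rw [← hY.integral_comp_zero φ x]
  simp only [discounted, WithTop.coe_ne_top, if_false, WithTop.untopD_coe, NNReal.coe_zero,
    mul_zero, Real.exp_zero, one_mul]

theorem isStoppingTime_parisianTime (hY : IsCTMC G Y P) (L : ℝ) (D : ℝ≥0) :
    IsStoppingTime (Filtration.natural Y hY.stronglyMeasurable) (parisianTime L D Y) :=
  ParisianOption.isStoppingTime_parisianTime hY.measurableSet_preimage hY.rightContinuous L D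

theorem integrable_downInPayoff (hY : IsCTMC G Y P) {r : ℝ} (hr : 0 ≤ r) (f : ℝ → ℝ) (L : ℝ)
    (D : ℝ≥0) {τ : Ω → WithTop ℝ≥0}
    (hτ : IsStoppingTime (Filtration.natural Y hY.stronglyMeasurable) τ) (x : S) :
    Integrable (downInPayoff r f L D Y τ) (P x) := by
  have hσ := hY.isStoppingTime_parisianTime L D
  exact (hY.integrable_discounted hr (fun y => f y) hτ x).indicator
    (hσ.measurableSpace_le _ (hσ.measurableSet_le_stopping_time hτ))

/-! ### Attainable functions and their supremum -/

/-- A function of the state whose discounted value at any stopping time is dominated by the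
expected reward from stopping later. -/
def IsAttainable (hY : IsCTMC G Y P) (r : ℝ) (f : ℝ → ℝ) (u : S → ℝ) : Prop :=
  ∀ (x : S) (σ : Ω → WithTop ℝ≥0),
    IsStoppingTime (Filtration.natural Y hY.stronglyMeasurable) σ →
    ∃ τ, IsStoppingTime (Filtration.natural Y hY.stronglyMeasurable) τ ∧ σ ≤ τ ∧
      ∫ ω, discounted r u Y σ ω ∂(P x) ≤ ∫ ω, discounted r (fun y => f y) Y τ ω ∂(P x)

/-- Stop at `σ` where the payoff is nonnegative and never stop elsewhere; never stopping pays `0`.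
-/
theorem isAttainable_posPart (hY : IsCTMC G Y P) (r : ℝ) (f : ℝ → ℝ) :
    hY.IsAttainable r f (fun y => max (f y) 0) := by
  classical
  intro x σ hσ
  refine ⟨restrictTime Y σ fun y => 0 ≤ f y, isStoppingTime_restrictTime
    hY.measurableSet_preimage hY.rightContinuous hσ _, fun ω => ?_, ?_⟩
  · unfold restrictTime; split_ifs
    exacts [le_rfl, le_top]
  · simp only [discounted_restrictTime]
    refine le_of_eq ?_
    congr! 4 with ω y
    split_ifs with h
    exacts [max_eq_left h, max_eq_right (not_le.1 h).le]

/-- Wait for `h`, then use attainability of `u` at `σ + h`; the strong Markov property matches the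
two expectations. -/
theorem IsAttainable.semigroup {hY : IsCTMC G Y P} {r : ℝ} {f : ℝ → ℝ} {u : S → ℝ}
    (hu : hY.IsAttainable r f u) (hr : 0 ≤ r) (h : ℝ≥0) :
    hY.IsAttainable r f (discountedSemigroup r Y P h u) := by
  intro x σ hσ
  obtain ⟨τ, hτ, hle, hint⟩ := hu x _ (isStoppingTime_add_const hσ h)
  refine ⟨τ, hτ, le_trans (fun ω => ?_) hle, ?_⟩
  · cases hs : σ ω with
    | top => simp only [WithTop.top_add, le_refl]
    | coe s => exact WithTop.coe_le_coe.2 le_self_add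
  · rwa [← hY.integral_discounted_add hr u hσ x h]

/-- Split `σ` according to which function is larger at `Y_σ` and follow the strategy of that
function on each part. Off its own part each strategy is forced to be `⊤`, so the minimum pastes
them together. -/
theorem IsAttainable.sup {hY : IsCTMC G Y P} {r : ℝ} {f : ℝ → ℝ} {u v : S → ℝ}
    (hu : hY.IsAttainable r f u) (hv : hY.IsAttainable r f v) (hr : 0 ≤ r) :
    hY.IsAttainable r f (u ⊔ v) := by
  classical
  intro x σ hσ
  have hres := fun B => isStoppingTime_restrictTime
    hY.measurableSet_preimage hY.rightContinuous hσ B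
  obtain ⟨τ₁, hτ₁, hle₁, hint₁⟩ := hu x _ (hres fun y => v y ≤ u y)
  obtain ⟨τ₂, hτ₂, hle₂, hint₂⟩ := hv x _ (hres fun y => ¬ v y ≤ u y)
  have hcases : ∀ ω, (σ ω ≤ τ₁ ω ∧ τ₂ ω = ⊤) ∨ (σ ω ≤ τ₂ ω ∧ τ₁ ω = ⊤) := fun ω => by
    have h1 := hle₁ ω
    have h2 := hle₂ ω
    by_cases hB : v (Y ((σ ω).untopD 0) ω) ≤ u (Y ((σ ω).untopD 0) ω)
    · rw [restrictTime_of_pos hB] at h1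
      rw [restrictTime_of_neg (not_not.2 hB), top_le_iff] at h2
      exact Or.inl ⟨h1, h2⟩
    · rw [restrictTime_of_neg hB, top_le_iff] at h1
      rw [restrictTime_of_pos (B := fun y => ¬ v y ≤ u y) hB] at h2
      exact Or.inr ⟨h2, h1⟩
  refine ⟨fun ω => min (τ₁ ω) (τ₂ ω), hτ₁.min hτ₂, fun ω => ?_, ?_⟩
  · rcases hcases ω with h | h
    · simpa only [h.2, min_top_right] using h.1
    · simpa only [h.2, min_top_left] using h.1
  have hL : ∀ ω, discounted r (u ⊔ v) Y σ ω =
      discounted r u Y (restrictTime Y σ fun y => v y ≤ u y) ω +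
      discounted r v Y (restrictTime Y σ fun y => ¬ v y ≤ u y) ω := fun ω => by
    rw [discounted_restrictTime, discounted_restrictTime]
    simp only [discounted, Pi.sup_apply]
    split_ifs with h1 h2
    · simp
    · simp [sup_eq_left.2 h2]
    · simp [sup_eq_right.2 (not_le.1 h2).le]
  have hR : ∀ ω, discounted r (fun y => f y) Y (fun ω => min (τ₁ ω) (τ₂ ω)) ω =
      discounted r (fun y => f y) Y τ₁ ω + discounted r (fun y => f y) Y τ₂ ω := fun ω => by
    rcases hcases ω with h | h
    · rw [discounted_of_eq_top h.2, add_zero]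
      exact discounted_congr (by simp only [h.2, min_top_right])
    · rw [discounted_of_eq_top h.2, zero_add]
      exact discounted_congr (by simp only [h.2, min_top_left])
  simp only [hL, hR]
  rw [integral_add (hY.integrable_discounted hr _ (hres _) x)
      (hY.integrable_discounted hr _ (hres _) x),
    integral_add (hY.integrable_discounted hr _ hτ₁ x) (hY.integrable_discounted hr _ hτ₂ x)]
  exact add_le_add hint₁ hint₂

theorem bddAbove_vanillaRewards (hY : IsCTMC G Y P) {r : ℝ} (hr : 0 ≤ r) (f : ℝ → ℝ) (x : S) :
    BddAbove (vanillaRewards r f Y hY.stronglyMeasurable P x) := by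
  have := hY.isProbabilityMeasure x
  obtain ⟨C, hC⟩ := (hY.isBoundedRightContinuous_zero hr fun y => f y).bounded
  refine ⟨C, ?_⟩
  rintro _ ⟨τ, hτ, rfl⟩
  calc ∫ ω, vanillaPayoff r f Y τ ω ∂(P x) ≤ ∫ _, C ∂(P x) :=
        integral_mono (hY.integrable_discounted hr (fun y => f y) hτ x) (integrable_const C)
          fun ω => (le_abs_self _).trans (abs_atTime_le hC τ ω)
    _ = C := by simp

theorem bddAbove_downInRewards (hY : IsCTMC G Y P) {r : ℝ} (hr : 0 ≤ r) (f : ℝ → ℝ) (L : ℝ)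
    (D : ℝ≥0) (x : S) :
    BddAbove (downInRewards r f L D Y hY.stronglyMeasurable P x) := by
  have := hY.isProbabilityMeasure x
  obtain ⟨C, hC⟩ := (hY.isBoundedRightContinuous_zero hr fun y => f y).bounded
  refine ⟨C, ?_⟩
  rintro _ ⟨τ, hτ, rfl⟩
  calc ∫ ω, downInPayoff r f L D Y τ ω ∂(P x) ≤ ∫ _, C ∂(P x) := by
        refine integral_mono (hY.integrable_downInPayoff hr f L D hτ x) (integrable_const C)
          fun ω => ?_
        refine Set.indicator_apply_le' (fun _ => ?_) fun _ => (abs_nonneg _).trans (hC 0 ω)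
        exact (le_abs_self _).trans (abs_atTime_le hC τ ω)
    _ = C := by simp

theorem IsAttainable.le_vanillaPrice {hY : IsCTMC G Y P} {r : ℝ} {f : ℝ → ℝ} {u : S → ℝ}
    (hu : hY.IsAttainable r f u) (hr : 0 ≤ r) (y : S) :
    u y ≤ vanillaPrice r f Y hY.stronglyMeasurable P y := by
  obtain ⟨τ, hτ, -, hint⟩ := hu y _ (isStoppingTime_const _ 0)
  rw [hY.integral_discounted_zero] at hint
  exact hint.trans (le_csSup (hY.bddAbove_vanillaRewards hr f y) ⟨τ, hτ, rfl⟩)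

/-- The largest value attainable by stopping. -/
noncomputable def attainableValue (hY : IsCTMC G Y P) (r : ℝ) (f : ℝ → ℝ) (y : S) : ℝ :=
  ⨆ u : {u // hY.IsAttainable r f u}, u.1 y

theorem IsAttainable.le_attainableValue {hY : IsCTMC G Y P} {r : ℝ} {f : ℝ → ℝ} {u : S → ℝ}
    (hu : hY.IsAttainable r f u) (hr : 0 ≤ r) (y : S) : u y ≤ hY.attainableValue r f y :=
  le_ciSup (f := fun u : {u // hY.IsAttainable r f u} => u.1 y)
    ⟨_, by rintro _ ⟨v, rfl⟩; exact v.2.le_vanillaPrice hr y⟩ ⟨u, hu⟩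

/-- Take a nearly optimal attainable function for each of the finitely many states; their maximum is
attainable and works at all states at once. -/
theorem exists_isAttainable_attainableValue_le (hY : IsCTMC G Y P) {r : ℝ} (hr : 0 ≤ r)
    (f : ℝ → ℝ) {ε : ℝ} (hε : 0 < ε) :
    ∃ u, hY.IsAttainable r f u ∧ ∀ y, hY.attainableValue r f y ≤ u y + ε := by
  have : Nonempty {u // hY.IsAttainable r f u} := ⟨⟨_, hY.isAttainable_posPart r f⟩⟩
  have h1 : ∀ y, ∃ u : {u // hY.IsAttainable r f u}, hY.attainableValue r f y - ε < u.1 y :=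
    fun y => exists_lt_of_lt_ciSup (sub_lt_self _ hε)
  choose v hv using h1
  rcases isEmpty_or_nonempty S with hS | hS
  · exact ⟨_, hY.isAttainable_posPart r f, fun y => isEmptyElim y⟩
  refine ⟨Finset.univ.sup' Finset.univ_nonempty fun y => (v y).1,
    Finset.sup'_induction _ _ (fun a ha b hb => ha.sup hb hr) fun y _ => (v y).2, fun y => ?_⟩
  have h2 : (v y).1 y ≤ _ := Finset.le_sup' (fun y => (v y).1) (Finset.mem_univ y) y
  linarith [hv y]

theorem posPart_le_attainableValue (hY : IsCTMC G Y P) {r : ℝ} (hr : 0 ≤ r) (f : ℝ → ℝ) (y : S) :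
    max (f y) 0 ≤ hY.attainableValue r f y :=
  (hY.isAttainable_posPart r f).le_attainableValue hr y

/-- Excessivity of the supremum: the semigroup maps a uniform approximant to an attainable function,
and discounting does not enlarge the error. -/
theorem discountedSemigroup_attainableValue_le (hY : IsCTMC G Y P) {r : ℝ} (hr : 0 ≤ r)
    (f : ℝ → ℝ) (h : ℝ≥0) (y : S) :
    discountedSemigroup r Y P h (hY.attainableValue r f) y ≤ hY.attainableValue r f y := by
  have := hY.isProbabilityMeasure y
  refine le_of_forall_pos_le_add fun ε hε => ?_
  obtain ⟨u, hu, hle⟩ := hY.exists_isAttainable_attainableValue_le hr f hε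
  calc discountedSemigroup r Y P h (hY.attainableValue r f) y
      ≤ Real.exp (-r * h) * ∫ ω, (u (Y h ω) + ε) ∂(P y) :=
        mul_le_mul_of_nonneg_left (integral_mono (hY.integrable_comp _ h y)
          ((hY.integrable_comp u h y).add (integrable_const ε)) fun ω => hle _)
          (Real.exp_nonneg _)
    _ = discountedSemigroup r Y P h u y + Real.exp (-r * h) * ε := by
        rw [integral_add (hY.integrable_comp u h y) (integrable_const ε), mul_add]
        simp [discountedSemigroup]
    _ ≤ hY.attainableValue r f y + ε :=
        add_le_add ((hu.semigroup hr h).le_attainableValue hr y)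
          (mul_le_of_le_one_left hε.le (exp_neg_mul_le_one hr h))

theorem vanillaPrice_eq_attainableValue (hY : IsCTMC G Y P) {r : ℝ} (hr : 0 ≤ r) (f : ℝ → ℝ)
    (y : S) :
    vanillaPrice r f Y hY.stronglyMeasurable P y = hY.attainableValue r f y := by
  have : Nonempty {u // hY.IsAttainable r f u} := ⟨⟨_, hY.isAttainable_posPart r f⟩⟩
  have hpos := hY.posPart_le_attainableValue hr f
  refine le_antisymm (csSup_le ⟨_, _, isStoppingTime_const _ 0, rfl⟩ ?_)
    (ciSup_le fun u => u.2.le_vanillaPrice hr y)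
  rintro _ ⟨τ, hτ, rfl⟩
  calc ∫ ω, vanillaPayoff r f Y τ ω ∂(P y)
      ≤ ∫ ω, discounted r (hY.attainableValue r f) Y τ ω ∂(P y) :=
        integral_mono (hY.integrable_discounted hr (fun y => f y) hτ y)
          (hY.integrable_discounted hr _ hτ y)
          (discounted_mono (fun z => (le_max_left _ _).trans (hpos z)) τ)
    _ ≤ ∫ ω, discounted r (hY.attainableValue r f) Y
          (fun _ => ((0 : ℝ≥0) : WithTop ℝ≥0)) ω ∂(P y) :=
        hY.integral_discounted_le hr (fun z => (le_max_right _ _).trans (hpos z))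
          (hY.discountedSemigroup_attainableValue_le hr f) (isStoppingTime_const _ 0) hτ
          (fun ω => zero_le) y
    _ = hY.attainableValue r f y := hY.integral_discounted_zero r _ y

theorem downInPrice_eq_integral (hY : IsCTMC G Y P) {r : ℝ} (hr : 0 ≤ r) (f : ℝ → ℝ) (L : ℝ)
    (D : ℝ≥0) (x : S) :
    downInPrice r f L D Y hY.stronglyMeasurable P x =
      ∫ ω, discounted r (hY.attainableValue r f) Y (parisianTime L D Y) ω ∂(P x) := by
  have := hY.isProbabilityMeasure x
  have hpos := hY.posPart_le_attainableValue hr f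
  have hσ := hY.isStoppingTime_parisianTime L D
  refine le_antisymm (csSup_le ⟨_, _, isStoppingTime_const _ 0, rfl⟩ ?_) ?_
  · rintro _ ⟨τ, hτ, rfl⟩
    -- Replacing `τ` by its maximum with the Parisian time changes nothing where the payoff counts,
    -- and elsewhere adds a nonnegative value.
    refine le_trans (integral_mono (hY.integrable_downInPayoff hr f L D hτ x)
      (hY.integrable_discounted hr (hY.attainableValue r f) (hσ.max hτ) x) fun ω => ?_)
      (hY.integral_discounted_le hr (fun z => (le_max_right _ _).trans (hpos z))
        (hY.discountedSemigroup_attainableValue_le hr f) hσ (hσ.max hτ)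
        (fun ω => le_max_left _ _) x)
    refine Set.indicator_apply_le' (fun hω => ?_)
      fun _ => discounted_nonneg (fun z => (le_max_right _ _).trans (hpos z)) _ ω
    rw [discounted_congr (σ := fun ω => max (parisianTime L D Y ω) (τ ω)) (max_eq_right hω)]
    exact discounted_mono (fun z => (le_max_left _ _).trans (hpos z)) τ ω
  · refine le_of_forall_pos_le_add fun ε hε => ?_
    obtain ⟨u, hu, hle⟩ := hY.exists_isAttainable_attainableValue_le hr f hε
    -- Attainability at the Parisian time supplies a rule that never exercises before activation, so
    -- its indicator is identically `1`.
    obtain ⟨τ, hτ, hστ, hint⟩ := hu x _ hσ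
    calc ∫ ω, discounted r (hY.attainableValue r f) Y (parisianTime L D Y) ω ∂(P x)
        ≤ ∫ ω, (discounted r u Y (parisianTime L D Y) ω + ε) ∂(P x) :=
          integral_mono (hY.integrable_discounted hr _ hσ x)
            ((hY.integrable_discounted hr _ hσ x).add (integrable_const ε))
            (discounted_add_const_le hr hε.le hle _)
      _ = ∫ ω, discounted r u Y (parisianTime L D Y) ω ∂(P x) + ε := by
          rw [integral_add (hY.integrable_discounted hr _ hσ x) (integrable_const ε)]
          simp
      _ ≤ downInPrice r f L D Y hY.stronglyMeasurable P x + ε := by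
          refine add_le_add (hint.trans (le_csSup (hY.bddAbove_downInRewards hr f L D x)
            ⟨τ, hτ, ?_⟩)) le_rfl
          refine integral_congr_ae (Eventually.of_forall fun ω => ?_)
          exact (Set.indicator_of_mem (s := {ω' | parisianTime L D Y ω' ≤ τ ω'}) (hστ ω) _).symm

end IsCTMC

end Pricing
end ParisianOption

theorem mainTheorem9 {Ω : Type*} [MeasurableSpace Ω] {S : Finset ℝ} (G : Matrix S S ℝ)
    (Y : ℝ≥0 → Ω → S) (P : S → Measure Ω) (hY : ParisianOption.IsCTMC G Y P)
    (r : ℝ) (hr : 0 ≤ r) (f : ℝ → ℝ) (L : ℝ) (D : ℝ≥0) :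
    -- all the expectations exist and both suprema are finite
    (∀ (x : S) (τ : Ω → WithTop ℝ≥0),
        IsStoppingTime (Filtration.natural Y hY.stronglyMeasurable) τ →
          Integrable (ParisianOption.vanillaPayoff r f Y τ) (P x) ∧
          Integrable (ParisianOption.downInPayoff r f L D Y τ) (P x)) ∧
    (∀ x y : S, Integrable (ParisianOption.activation r L D Y y) (P x)) ∧
    (∀ x : S, BddAbove (ParisianOption.vanillaRewards r f Y hY.stronglyMeasurable P x)) ∧
    (∀ x : S, BddAbove (ParisianOption.downInRewards r f L D Y hY.stronglyMeasurable P x)) ∧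
    -- the decomposition
    ∀ x : S,
      ParisianOption.downInPrice r f L D Y hY.stronglyMeasurable P x =
        ∑ y : S, ParisianOption.activationTransform r L D Y P x y *
          ParisianOption.vanillaPrice r f Y hY.stronglyMeasurable P y := by
  have hact : ∀ x y : S, Integrable (ParisianOption.activation r L D Y y) (P x) := fun x y =>
    hY.integrable_discounted hr _ (hY.isStoppingTime_parisianTime L D) x
  refine ⟨fun x τ hτ => ⟨hY.integrable_discounted hr (fun y => f y) hτ x,
    hY.integrable_downInPayoff hr f L D hτ x⟩, hact, hY.bddAbove_vanillaRewards hr f,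
    hY.bddAbove_downInRewards hr f L D, fun x => ?_⟩
  rw [hY.downInPrice_eq_integral hr]
  -- Split according to the state at activation; paths that never activate contribute `0` on both
  -- sides.
  simp only [ParisianOption.discounted_eq_sum_activation, hY.vanillaPrice_eq_attainableValue hr]
  rw [integral_finsetSum _ fun y _ => (hact x y).mul_const _]
  exact Finset.sum_congr rfl fun y _ => integral_mul_const _ _
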